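/- For $S\subseteq\mathbb R^n$ and $d\ge 0$ let $\mathcal B_d(S)$ be the real vector space of all polynomials $p\in\mathbb R[x_1,\dots,x_n]$ for which there is a polynomial $q\in\mathbb R[x_1,\dots,x_n]$ of total degree at most $2d$ with $p^2\le q$ on $S$; in particular, $\mathcal B_0(S)$ consists of the polynomials that are bounded on $S$. Let $$S_1=\{(a,b)\in\mathbb R^2 \mid a\ge 1,\ 1\le a^3b+a^6-a\le 2\},\qquad S_2=\{(a,b)\in\mathbb R^2 \mid a\ge 1,\ 1\le a^3b-a^6-a\le 2\},$$ and $S=S_1\cup S_2$. Then $S$ is basic closed semialgebraic (the solution set in $\mathbb R^2$ of finitely many simultaneous non-strict polynomial inequalities) and regular (it contains an open subset of $\mathbb R^2$ that is dense in $S$), every polynomial bounded on $S$ is constant, i.e. $\mathcal B_0(S)=\mathbb R$, but the real vector space $\mathcal B_1(S)$ is infinite-dimensional. -/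

import Mathlib

/-- `GrowthModule S d` is the real vector space `B_d(S)` of those polynomials `p` in `n` variables
for which there is a polynomial `q` of total degree at most `2 * d` with `p ^ 2 ≤ q` on `S`. -/
def GrowthModule {n : ℕ} (S : Set (Fin n → ℝ)) (d : ℕ) :
    Submodule ℝ (MvPolynomial (Fin n) ℝ) where
  carrier := {p | ∃ q : MvPolynomial (Fin n) ℝ, q.totalDegree ≤ 2 * d ∧
    ∀ x ∈ S, MvPolynomial.eval x p ^ 2 ≤ MvPolynomial.eval x q}
  zero_mem' := ⟨0, by simp, fun x _ => by simp⟩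
  add_mem' := by
    rintro p p' ⟨q, hq, h⟩ ⟨q', hq', h'⟩
    refine ⟨(2 : ℝ) • (q + q'), ?_, fun x hx => ?_⟩
    · exact (MvPolynomial.totalDegree_smul_le _ _).trans
        ((MvPolynomial.totalDegree_add _ _).trans (max_le hq hq'))
    · rw [MvPolynomial.smul_eval, map_add, map_add]
      nlinarith [h x hx, h' x hx,
        sq_nonneg (MvPolynomial.eval x p - MvPolynomial.eval x p')]
  smul_mem' := by
    rintro c p ⟨q, hq, h⟩
    refine ⟨(c ^ 2) • q, (MvPolynomial.totalDegree_smul_le _ _).trans hq, fun x hx => ?_⟩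
    rw [MvPolynomial.smul_eval, MvPolynomial.smul_eval, mul_pow]
    exact mul_le_mul_of_nonneg_left (h x hx) (sq_nonneg c)

/-- A basic closed semialgebraic set: the solution set of finitely many simultaneous non-strict
polynomial inequalities. -/
def IsBasicClosed {n : ℕ} (S : Set (Fin n → ℝ)) : Prop :=
  ∃ F : Finset (MvPolynomial (Fin n) ℝ), S = {x | ∀ f ∈ F, 0 ≤ MvPolynomial.eval x f}

/-- A set is regular if it contains an open subset of the ambient space that is dense in it. -/
def IsRegularSet {n : ℕ} (S : Set (Fin n → ℝ)) : Prop :=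
  ∃ U : Set (Fin n → ℝ), IsOpen U ∧ U ⊆ S ∧ S ⊆ closure U

/-- The tentacle `S₁`, along the curve `b = -a ^ 3 + a ^ (-2)`. -/
def lowerTentacle : Set (Fin 2 → ℝ) :=
  {x | 1 ≤ x 0 ∧ 1 ≤ x 0 ^ 3 * x 1 + x 0 ^ 6 - x 0 ∧ x 0 ^ 3 * x 1 + x 0 ^ 6 - x 0 ≤ 2}

/-- The tentacle `S₂`, along the curve `b = a ^ 3 + a ^ (-2)`. -/
def upperTentacle : Set (Fin 2 → ℝ) :=
  {x | 1 ≤ x 0 ∧ 1 ≤ x 0 ^ 3 * x 1 - x 0 ^ 6 - x 0 ∧ x 0 ^ 3 * x 1 - x 0 ^ 6 - x 0 ≤ 2}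

/-! Both tentacles lie on one family of curves `y = x ^ 3 + x ^ (-2) + t * x ^ (-3)`: the upper one
has `x ≥ 1`, `t ∈ [1, 2]`, and reflecting the lower one by `x ↦ -x` gives `x ≤ -1`, `t ∈ [-2, -1]`.
Growth of a polynomial even in `x` is therefore read off its restriction to `ℝ[t][x, x⁻¹]` as degree
in `x`. Give `x` and `t` degree 1. Then `x ^ 2`, `y` and `(y ^ 2 - x ^ 6) / 2` have leading forms `x
^ 2`, `x ^ 3` and `x + t`, with errors at least five degrees lower.

Infinite dimension: these forms generate every `x ^ e * t ^ l` with `e ≥ 2`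
(`exists_hasLeadingForm`), so correcting errors recursively realises any `x ^ 2 * g(t)` up to terms
of degree at most 1 in `x` (`exists_sub_mem_xDegreeLE`). The resulting polynomials are `O(x ^ 2)` on
the tentacles, where `x ^ 6` is dominated by a quadratic in `y`.

Bounded polynomials: a bounded even polynomial has a top form that is a combination of terms `(x +
t) ^ c * x ^ k` with `k ≠ 1` and is free of positive powers of `x`. The missing exponent 1 makes
this impossible in positive degree (`exists_eq_C_of_even`). For arbitrary bounded `p`, the sum and
product of `p` and its reflection are even and bounded, hence constant, so `p` solves a quadratic
equation with constant coefficients. -/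

open Polynomial LaurentPolynomial

/-! ### Monomials and degree filtrations of the curve ring -/

/-- Curve coordinates: the Laurent polynomials in `x` whose coefficients are polynomials in `t`. -/
abbrev CurveRing : Type := LaurentPolynomial ℝ[X]

/-- The monomial `x ^ e * t ^ l`. -/
noncomputable def curveMonomial (e : ℤ) (l : ℕ) : CurveRing :=
  AddMonoidAlgebra.single e (X ^ l)

/-- The span of the monomials `x ^ e * t ^ l` with `P e l`. -/
noncomputable def monomialSpan (P : ℤ → ℕ → Prop) : Submodule ℝ CurveRing :=
  Submodule.span ℝ {h | ∃ e l, P e l ∧ h = curveMonomial e l}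

lemma curveMonomial_mul (e e' : ℤ) (l l' : ℕ) :
    curveMonomial e l * curveMonomial e' l' = curveMonomial (e + e') (l + l') := by
  rw [curveMonomial, curveMonomial, AddMonoidAlgebra.single_mul_single, ← pow_add, curveMonomial]

lemma curveMonomial_zero : curveMonomial 0 0 = 1 := by
  simp only [curveMonomial, pow_zero]; rfl

lemma curveMonomial_mem {P : ℤ → ℕ → Prop} {e : ℤ} {l : ℕ} (h : P e l) :
    curveMonomial e l ∈ monomialSpan P :=
  Submodule.subset_span ⟨e, l, h, rfl⟩

lemma monomialSpan_mono {P Q : ℤ → ℕ → Prop} (h : ∀ e l, P e l → Q e l) :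
    monomialSpan P ≤ monomialSpan Q :=
  Submodule.span_mono fun _ ⟨e, l, hP, he⟩ => ⟨e, l, h e l hP, he⟩

lemma coeff_curveMonomial (e e' : ℤ) (l l' : ℕ) :
    ((curveMonomial e l).coeff e').coeff l' = if e = e' ∧ l = l' then (1 : ℝ) else 0 := by
  unfold curveMonomial
  rw [AddMonoidAlgebra.coeff_single, Finsupp.single_apply]
  split_ifs <;> simp_all [coeff_X_pow]; omega

/-- The coefficient of `x ^ e * t ^ l`. -/
noncomputable def curveCoeff (e : ℤ) (l : ℕ) : CurveRing →ₗ[ℝ] ℝ where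
  toFun h := (h.coeff e).coeff l
  map_add' := by simp
  map_smul' := by simp

lemma curveCoeff_curveMonomial (e e' : ℤ) (l l' : ℕ) :
    curveCoeff e' l' (curveMonomial e l) = if e = e' ∧ l = l' then (1 : ℝ) else 0 :=
  coeff_curveMonomial e e' l l'

lemma curveCoeff_eq_zero {P : ℤ → ℕ → Prop} {h : CurveRing} (hh : h ∈ monomialSpan P) {e : ℤ}
    {l : ℕ} (hP : ¬ P e l) : curveCoeff e l h = 0 := by
  have : monomialSpan P ≤ LinearMap.ker (curveCoeff e l) := by
    refine Submodule.span_le.2 ?_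
    rintro _ ⟨e', l', h', rfl⟩
    simp only [SetLike.mem_coe, LinearMap.mem_ker, curveCoeff_curveMonomial]
    rw [if_neg]
    rintro ⟨rfl, rfl⟩
    exact hP h'
  exact this hh

lemma mem_monomialSpan_of_coeff {P : ℤ → ℕ → Prop} {h : CurveRing}
    (hh : ∀ e l, ¬ P e l → curveCoeff e l h = 0) : h ∈ monomialSpan P := by
  have key : h = ∑ e ∈ h.coeff.support, ∑ l ∈ (h.coeff e).support,
      curveCoeff e l h • curveMonomial e l := by
    have h1 : h = ∑ e ∈ h.coeff.support, AddMonoidAlgebra.single e (h.coeff e) := by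
      conv_lhs => rw [← AddMonoidAlgebra.sum_coeff_single h]
      rfl
    conv_lhs => rw [h1]
    refine Finset.sum_congr rfl fun e _ => ?_
    conv_lhs => rw [(h.coeff e).as_sum_support]
    rw [← AddMonoidAlgebra.singleAddHom_apply, map_sum]
    refine Finset.sum_congr rfl fun l _ => ?_
    rw [AddMonoidAlgebra.singleAddHom_apply, curveMonomial, AddMonoidAlgebra.smul_single,
      ← C_mul_X_pow_eq_monomial, ← Polynomial.smul_eq_C_mul]
    rfl
  rw [key]
  refine Submodule.sum_mem _ fun e _ => Submodule.sum_mem _ fun l _ => ?_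
  by_cases hP : P e l
  · exact Submodule.smul_mem _ _ (curveMonomial_mem hP)
  · simp [hh e l hP]

/-- Total degree at most `N`. -/
noncomputable abbrev totalDegreeLE (N : ℤ) : Submodule ℝ CurveRing :=
  monomialSpan fun e l => e + l ≤ N

/-- Degree at most `k` in `x`. -/
noncomputable abbrev xDegreeLE (k : ℤ) : Submodule ℝ CurveRing :=
  monomialSpan fun e _ => e ≤ k

lemma totalDegreeLE_mono {M N : ℤ} (h : M ≤ N) : totalDegreeLE M ≤ totalDegreeLE N :=
  monomialSpan_mono fun _ _ h' => h'.trans h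

lemma mul_mem_totalDegreeLE {M N : ℤ} {a b : CurveRing} (ha : a ∈ totalDegreeLE M)
    (hb : b ∈ totalDegreeLE N) : a * b ∈ totalDegreeLE (M + N) := by
  have h := Submodule.mul_mem_mul ha hb
  refine (?_ : totalDegreeLE M * totalDegreeLE N ≤ _) h
  unfold totalDegreeLE monomialSpan
  rw [Submodule.span_mul_span, Submodule.span_le]
  rintro _ ⟨_, ⟨e, l, h1, rfl⟩, _, ⟨e', l', h2, rfl⟩, rfl⟩
  refine Submodule.subset_span ⟨e + e', l + l', ?_, curveMonomial_mul _ _ _ _⟩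
  push_cast
  linarith

/-! ### Leading forms -/

/-- `a` has leading form `a'` of total degree at most `p`, up to an error of total degree at most
`p - 5`. -/
def HasLeadingForm (p : ℤ) (a a' : CurveRing) : Prop :=
  a' ∈ totalDegreeLE p ∧ a - a' ∈ totalDegreeLE (p - 5)

lemma HasLeadingForm.mul {p q : ℤ} {a a' b b' : CurveRing} (ha : HasLeadingForm p a a')
    (hb : HasLeadingForm q b b') : HasLeadingForm (p + q) (a * b) (a' * b') := by
  refine ⟨mul_mem_totalDegreeLE ha.1 hb.1, ?_⟩
  have e : a * b - a' * b' = (a - a') * (b - b') + (a - a') * b' + a' * (b - b') := by ring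
  rw [e]
  refine add_mem (add_mem ?_ ?_) ?_
  · exact totalDegreeLE_mono (by linarith) (mul_mem_totalDegreeLE ha.2 hb.2)
  · exact totalDegreeLE_mono (by linarith) (mul_mem_totalDegreeLE ha.2 hb.1)
  · exact totalDegreeLE_mono (by linarith) (mul_mem_totalDegreeLE ha.1 hb.2)

lemma HasLeadingForm.sub {p : ℤ} {a a' b b' : CurveRing} (ha : HasLeadingForm p a a')
    (hb : HasLeadingForm p b b') : HasLeadingForm p (a - b) (a' - b') :=
  ⟨sub_mem ha.1 hb.1, by simpa [sub_sub_sub_comm] using sub_mem ha.2 hb.2⟩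

lemma hasLeadingForm_refl {p : ℤ} {a : CurveRing} (ha : a ∈ totalDegreeLE p) :
    HasLeadingForm p a a := ⟨ha, by simp⟩

lemma HasLeadingForm.pow {p : ℤ} {a a' : CurveRing} (ha : HasLeadingForm p a a') (n : ℕ) :
    HasLeadingForm (n * p) (a ^ n) (a' ^ n) := by
  induction n with
  | zero =>
    simp only [pow_zero, Nat.cast_zero, zero_mul]
    refine hasLeadingForm_refl ?_
    rw [← curveMonomial_zero]
    exact curveMonomial_mem (by simp)
  | succ n ih =>
    rw [pow_succ, pow_succ]
    convert! ih.mul ha using 1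
    push_cast; ring

/-! ### Restriction of even polynomials to the curves -/

/-- Restriction of a polynomial to the curves `y = x ^ 3 + x ^ (-2) + t * x ^ (-3)`. -/
noncomputable def toCurve : MvPolynomial (Fin 2) ℝ →ₐ[ℝ] CurveRing :=
  MvPolynomial.aeval ![curveMonomial 1 0,
    curveMonomial 3 0 + curveMonomial (-2) 0 + curveMonomial (-3) 1]

/-- The substitution `x ↦ -x`. -/
noncomputable def reflectX : MvPolynomial (Fin 2) ℝ →ₐ[ℝ] MvPolynomial (Fin 2) ℝ :=
  MvPolynomial.aeval ![-MvPolynomial.X 0, MvPolynomial.X 1]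

/-- The polynomial `(y ^ 2 - x ^ 6) / 2`, with leading form `x + t`. -/
noncomputable def halfDiff : MvPolynomial (Fin 2) ℝ :=
  MvPolynomial.C (1 / 2) * (MvPolynomial.X 1 ^ 2 - MvPolynomial.X 0 ^ 6)

lemma toCurve_X_zero : toCurve (MvPolynomial.X 0) = curveMonomial 1 0 := by simp [toCurve]

lemma toCurve_X_one : toCurve (MvPolynomial.X 1) =
    curveMonomial 3 0 + curveMonomial (-2) 0 + curveMonomial (-3) 1 := by simp [toCurve]

lemma curveMonomial_pow (e : ℤ) (l n : ℕ) :
    curveMonomial e l ^ n = curveMonomial (n * e) (n * l) := by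
  induction n with
  | zero => simp [curveMonomial_zero]
  | succ n ih =>
    rw [pow_succ, ih, curveMonomial_mul]
    congr 1
    · push_cast; ring
    · ring

lemma hasLeadingForm_X_sq :
    HasLeadingForm 2 (toCurve (MvPolynomial.X 0 ^ 2)) (curveMonomial 2 0) := by
  rw [map_pow, toCurve_X_zero, curveMonomial_pow]
  exact hasLeadingForm_refl (curveMonomial_mem (by norm_num))

lemma hasLeadingForm_X_one :
    HasLeadingForm 3 (toCurve (MvPolynomial.X 1)) (curveMonomial 3 0) := by
  refine ⟨curveMonomial_mem (by norm_num), ?_⟩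
  rw [toCurve_X_one, add_assoc, add_sub_cancel_left]
  exact add_mem (curveMonomial_mem (by norm_num)) (curveMonomial_mem (by norm_num))

lemma toCurve_halfDiff : toCurve halfDiff = curveMonomial 1 0 + curveMonomial 0 1 +
    (1 / 2 : ℝ) • (curveMonomial (-4) 0 + (2 : ℝ) • curveMonomial (-5) 1 +
      curveMonomial (-6) 2) := by
  have h : ∀ (e e' : ℤ) (l l' : ℕ) (r : ℝ), curveMonomial e l * r • curveMonomial e' l' =
      r • curveMonomial (e + e') (l + l') := fun e e' l l' r => by
    rw [mul_smul_comm, curveMonomial_mul]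
  rw [halfDiff, map_mul, map_sub, map_pow, map_pow, toCurve_X_zero, toCurve_X_one,
    MvPolynomial.C_eq_smul_one, map_smul, map_one, smul_mul_assoc, one_mul]
  simp only [sq, add_mul, mul_add, curveMonomial_mul, curveMonomial_pow]
  norm_num
  module

lemma hasLeadingForm_halfDiff :
    HasLeadingForm 1 (toCurve halfDiff) (curveMonomial 1 0 + curveMonomial 0 1) := by
  refine ⟨add_mem (curveMonomial_mem (by norm_num)) (curveMonomial_mem (by norm_num)), ?_⟩
  rw [toCurve_halfDiff, add_sub_cancel_left]
  refine Submodule.smul_mem _ _ (add_mem (add_mem ?_ (Submodule.smul_mem _ _ ?_)) ?_) <;>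
    exact curveMonomial_mem (by norm_num)

lemma reflectX_X_sq : reflectX (MvPolynomial.X 0 ^ 2) = MvPolynomial.X 0 ^ 2 := by simp [reflectX]

lemma reflectX_X_one : reflectX (MvPolynomial.X 1) = MvPolynomial.X 1 := by simp [reflectX]

lemma reflectX_halfDiff : reflectX halfDiff = halfDiff := by
  simp [reflectX, halfDiff, MvPolynomial.algebraMap_eq, Even.neg_pow (by decide : Even 6)]

/-- Every monomial `x ^ e * t ^ l` with `e ≥ 2` is the leading form of an even polynomial. -/
lemma exists_hasLeadingForm (l : ℕ) : ∀ e : ℕ, 2 ≤ e → ∃ f, reflectX f = f ∧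
    HasLeadingForm (e + l) (toCurve f) (curveMonomial e l) := by
  induction l with
  | zero =>
    intro e he
    -- Here `b` is the parity of `e`; an odd `e ≥ 2` is at least 3, so the natural subtraction is
    -- exact.
    obtain ⟨a, b, rfl⟩ : ∃ a b : ℕ, e = a * 2 + b * 3 := ⟨(e - 3 * (e % 2)) / 2, e % 2, by omega⟩
    refine ⟨(MvPolynomial.X 0 ^ 2) ^ a * MvPolynomial.X 1 ^ b, ?_, ?_⟩
    · rw [map_mul, map_pow, map_pow reflectX (MvPolynomial.X 1), reflectX_X_sq, reflectX_X_one]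
    · rw [map_mul, map_pow, map_pow toCurve (MvPolynomial.X 1)]
      convert! (hasLeadingForm_X_sq.pow a).mul (hasLeadingForm_X_one.pow b) using 1
      · rw [curveMonomial_pow, curveMonomial_pow, curveMonomial_mul]
        congr 1
  | succ l ih =>
    intro e he
    obtain ⟨f, hf, hf'⟩ := ih e he
    obtain ⟨g, hg, hg'⟩ := ih (e + 1) (by omega)
    -- On leading forms: `x ^ e * t ^ (l + 1) = (x + t) * x ^ e * t ^ l - x ^ (e + 1) * t ^ l`.
    refine ⟨halfDiff * f - g, by rw [map_sub, map_mul, hf, hg, reflectX_halfDiff], ?_⟩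
    rw [map_sub, map_mul]
    have h := hasLeadingForm_halfDiff.mul hf'
    rw [show (1 : ℤ) + (e + l) = e + (l + 1 : ℕ) by push_cast; ring] at h
    rw [show ((e + 1 : ℕ) : ℤ) + l = e + (l + 1 : ℕ) by push_cast; ring] at hg'
    convert! h.sub hg' using 1
    rw [add_mul, curveMonomial_mul, curveMonomial_mul, zero_add, Nat.add_comm 1 l, zero_add,
      add_comm (1 : ℤ)]
    push_cast
    ring

/-- The restrictions of the even polynomials to the curves exhaust the curve ring up to degree
one in `x`. -/
lemma exists_sub_mem_xDegreeLE (N : ℕ) : ∀ h ∈ totalDegreeLE N, ∃ f, reflectX f = f ∧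
    toCurve f - h ∈ xDegreeLE 1 := by
  induction N with
  | zero =>
    intro h hh
    refine ⟨0, by simp, ?_⟩
    rw [map_zero, zero_sub]
    refine neg_mem (monomialSpan_mono (fun e l hel => ?_) hh)
    push_cast at hel
    omega
  | succ N ih =>
    intro h hh
    induction hh using Submodule.span_induction with
    | mem h hh =>
      obtain ⟨e, l, hel, rfl⟩ := hh
      by_cases he : e ≤ 1
      · exact ⟨0, by simp, by
          rw [map_zero, zero_sub]; exact neg_mem (curveMonomial_mem he)⟩
      · lift e to ℕ using by omega
        -- The error of `f` lies at least five total degrees lower, so the induction hypothesis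
        -- corrects it by `g`.
        obtain ⟨f, hf, hf'⟩ := exists_hasLeadingForm l e (by omega)
        obtain ⟨g, hg, hg'⟩ := ih (toCurve f - curveMonomial e l)
          (totalDegreeLE_mono (by push_cast at hel; omega) hf'.2)
        refine ⟨f - g, by rw [map_sub, hf, hg], ?_⟩
        rw [map_sub]
        convert! neg_mem hg' using 1
        ring
    | zero => exact ⟨0, by simp, by simp⟩
    | add h h' _ _ hh hh' =>
      obtain ⟨f, hf, hf'⟩ := hh
      obtain ⟨g, hg, hg'⟩ := hh'
      refine ⟨f + g, by rw [map_add, hf, hg], ?_⟩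
      rw [map_add, add_sub_add_comm]
      exact add_mem hf' hg'
    | smul r h _ hh =>
      obtain ⟨f, hf, hf'⟩ := hh
      refine ⟨r • f, by rw [map_smul, hf], ?_⟩
      rw [map_smul, ← smul_sub]
      exact Submodule.smul_mem _ _ hf'

/-! ### Points of the tentacles and growth along them -/

/-- Evaluation of an element of the curve ring at the values `x` and `t`. -/
noncomputable def curveEval (x : ℝˣ) (t : ℝ) : CurveRing →+* ℝ :=
  LaurentPolynomial.eval₂ (Polynomial.evalRingHom t) x

lemma curveEval_curveMonomial (x : ℝˣ) (t : ℝ) (e : ℤ) (l : ℕ) :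
    curveEval x t (curveMonomial e l) = (x : ℝ) ^ e * t ^ l := by
  rw [curveMonomial, LaurentPolynomial.single_eq_C_mul_T, curveEval,
    LaurentPolynomial.eval₂_C_mul_T]
  simp [mul_comm]

lemma curveEval_smul (x : ℝˣ) (t r : ℝ) (h : CurveRing) :
    curveEval x t (r • h) = r * curveEval x t h := by
  have : r • h = LaurentPolynomial.C (Polynomial.C r) * h := by
    rw [← LaurentPolynomial.smul_eq_C_mul]
    ext
    simp
  rw [this, map_mul]
  congr 1
  simp [curveEval]

/-- The point with parameter `t` over `x` on the curves defining the tentacles. -/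
noncomputable def curvePoint (x t : ℝ) : Fin 2 → ℝ :=
  ![x, x ^ 3 + x ^ (-2 : ℤ) + x ^ (-3 : ℤ) * t]

lemma curveEval_toCurve (x : ℝˣ) (t : ℝ) (f : MvPolynomial (Fin 2) ℝ) :
    curveEval x t (toCurve f) = MvPolynomial.eval (curvePoint x t) f := by
  have h : (curveEval x t).comp toCurve.toRingHom = MvPolynomial.eval (curvePoint x t) := by
    refine MvPolynomial.ringHom_ext (fun r => ?_) (fun i => ?_)
    · have h1 := curveEval_smul x t r 1
      rw [map_one, mul_one] at h1
      simp only [AlgHom.toRingHom_eq_coe, RingHom.coe_comp, RingHom.coe_coe, Function.comp_apply,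
        MvPolynomial.eval_C]
      rw [MvPolynomial.C_eq_smul_one, map_smul, map_one, h1]
    · fin_cases i
      · simp [toCurve, curveEval_curveMonomial, curvePoint]
      · simp [toCurve, curveEval_curveMonomial, curvePoint]
  exact RingHom.congr_fun h f

lemma eval_reflectX (x y : ℝ) (f : MvPolynomial (Fin 2) ℝ) :
    MvPolynomial.eval ![x, y] (reflectX f) = MvPolynomial.eval ![-x, y] f := by
  have h : (MvPolynomial.eval ![x, y]).comp reflectX.toRingHom =
      MvPolynomial.eval ![-x, y] := by
    refine MvPolynomial.ringHom_ext (fun r => ?_) (fun i => ?_)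
    · simp [reflectX, MvPolynomial.algebraMap_eq]
    · fin_cases i <;> simp [reflectX]
  exact RingHom.congr_fun h f

lemma mem_upperTentacle_iff (p : Fin 2 → ℝ) : p ∈ upperTentacle ↔
    ∃ x t, 1 ≤ x ∧ 1 ≤ t ∧ t ≤ 2 ∧ p = curvePoint x t := by
  constructor
  · rintro ⟨h0, h1, h2⟩
    refine ⟨p 0, _, h0, h1, h2, ?_⟩
    have : p 0 ≠ 0 := by positivity
    ext i
    fin_cases i
    · rfl
    · simp only [curvePoint, zpow_neg, Fin.mk_one, Matrix.cons_val_one, Matrix.cons_val_fin_one]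
      norm_cast
      field_simp
      ring
  · rintro ⟨x, t, hx, h1, h2, rfl⟩
    have : x ≠ 0 := by positivity
    have key : x ^ 3 * (x ^ 3 + x ^ (-2 : ℤ) + x ^ (-3 : ℤ) * t) - x ^ 6 - x = t := by
      simp only [zpow_neg]
      norm_cast
      field_simp
      ring
    refine ⟨hx, ?_, ?_⟩ <;> simp only [curvePoint, Matrix.cons_val_zero, Matrix.cons_val_one,
      Matrix.cons_val_fin_one, key] <;> assumption

lemma mem_lowerTentacle_iff (p : Fin 2 → ℝ) : p ∈ lowerTentacle ↔
    ∃ x t, 1 ≤ x ∧ 1 ≤ t ∧ t ≤ 2 ∧ p = ![x, curvePoint (-x) (-t) 1] := by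
  constructor
  · rintro ⟨h0, h1, h2⟩
    refine ⟨p 0, _, h0, h1, h2, ?_⟩
    have : p 0 ≠ 0 := by positivity
    ext i
    fin_cases i
    · rfl
    · simp only [curvePoint, zpow_neg, Fin.mk_one, Matrix.cons_val_one, Matrix.cons_val_fin_one]
      norm_cast
      field_simp
      ring
  · rintro ⟨x, t, hx, h1, h2, rfl⟩
    have : x ≠ 0 := by positivity
    have key : x ^ 3 * ((-x) ^ 3 + (-x) ^ (-2 : ℤ) + (-x) ^ (-3 : ℤ) * -t) + x ^ 6 - x = t := by
      simp only [zpow_neg]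
      norm_cast
      field_simp
      ring
    refine ⟨hx, ?_, ?_⟩ <;> simp only [curvePoint, Matrix.cons_val_zero, Matrix.cons_val_one,
      Matrix.cons_val_fin_one, key] <;> assumption

lemma exists_bound_of_mem_xDegreeLE (k : ℕ) {h : CurveRing} (hh : h ∈ xDegreeLE k) :
    ∃ C : ℝ, ∀ (x : ℝˣ) (t : ℝ), 1 ≤ |(x : ℝ)| → |t| ≤ 2 →
      |curveEval x t h| ≤ C * |(x : ℝ)| ^ k := by
  induction hh using Submodule.span_induction with
  | mem h hh =>
    obtain ⟨e, l, he, rfl⟩ := hh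
    refine ⟨2 ^ l, fun x t hx ht => ?_⟩
    rw [curveEval_curveMonomial, abs_mul, abs_zpow, abs_pow, mul_comm]
    refine mul_le_mul (pow_le_pow_left₀ (abs_nonneg t) ht l) ?_ (by positivity) (by positivity)
    rw [← zpow_natCast]
    exact zpow_le_zpow_right₀ hx he
  | zero => exact ⟨0, fun x t _ _ => by simp⟩
  | add h h' _ _ hh hh' =>
    obtain ⟨C, hC⟩ := hh
    obtain ⟨C', hC'⟩ := hh'
    refine ⟨C + C', fun x t hx ht => ?_⟩
    rw [map_add, add_mul]
    exact (abs_add_le _ _).trans (add_le_add (hC x t hx ht) (hC' x t hx ht))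
  | smul r h _ hh =>
    obtain ⟨C, hC⟩ := hh
    refine ⟨|r| * C, fun x t hx ht => ?_⟩
    rw [curveEval_smul, abs_mul, mul_assoc]
    exact mul_le_mul_of_nonneg_left (hC x t hx ht) (abs_nonneg r)

/-- On both tentacles, `x ^ 6` is bounded by a quadratic polynomial in `y`. -/
lemma pow_six_le (x t : ℝ) (hx : 1 ≤ |x|) (ht : |t| ≤ 2) :
    x ^ 6 ≤ 2 * curvePoint x t 1 ^ 2 + 18 := by
  have h2 : |x ^ (-2 : ℤ)| ≤ 1 := by
    rw [abs_zpow]; exact zpow_le_one_of_nonpos₀ hx (by norm_num)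
  have h3 : |x ^ (-3 : ℤ)| ≤ 1 := by
    rw [abs_zpow]; exact zpow_le_one_of_nonpos₀ hx (by norm_num)
  have h4 : |x ^ (-3 : ℤ) * t| ≤ 1 * 2 := by
    rw [abs_mul]; exact mul_le_mul h3 ht (abs_nonneg _) (by norm_num)
  simp only [curvePoint, Matrix.cons_val_one, Matrix.cons_val_fin_one]
  generalize x ^ (-2 : ℤ) = u at *
  generalize x ^ (-3 : ℤ) * t = v at *
  have h5 : |u + v| ≤ 3 := (abs_add_le u v).trans (by linarith)
  have h6 : (u + v) ^ 2 ≤ 9 := by rw [← sq_abs]; nlinarith [abs_nonneg (u + v)]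
  -- With `w = u + v`: `2 * (x ^ 3 + w) ^ 2 + 2 * w ^ 2 - x ^ 6 = (x ^ 3 + 2 * w) ^ 2`, and `2 * w ^
  -- 2 ≤ 18`.
  nlinarith [sq_nonneg (x ^ 3 + 2 * (u + v))]

/-- Degree 3 in `x` is permitted because `f ^ 2` is then `O(x ^ 6)`, which a polynomial of degree 2
in `y` dominates. Evenness carries the bound at `(-x, -t)` over to the lower tentacle. -/
lemma mem_growthModule_one {f : MvPolynomial (Fin 2) ℝ} (hf : reflectX f = f)
    (h : toCurve f ∈ xDegreeLE 3) :
    f ∈ GrowthModule (lowerTentacle ∪ upperTentacle) 1 := by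
  obtain ⟨C, hC⟩ := exists_bound_of_mem_xDegreeLE 3 h
  have key : ∀ x t : ℝ, 1 ≤ |x| → |t| ≤ 2 →
      MvPolynomial.eval (curvePoint x t) f ^ 2 ≤ C ^ 2 * (2 * curvePoint x t 1 ^ 2 + 18) := by
    intro x t hx ht
    have hx0 : x ≠ 0 := by rintro rfl; norm_num at hx
    have h1 := hC (Units.mk0 x hx0) t hx ht
    rw [curveEval_toCurve, Units.val_mk0] at h1
    calc _ = |MvPolynomial.eval (curvePoint x t) f| ^ 2 := (sq_abs _).symm
      _ ≤ (C * |x| ^ 3) ^ 2 := pow_le_pow_left₀ (abs_nonneg _) h1 2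
      _ = C ^ 2 * |x| ^ 6 := by ring
      _ = C ^ 2 * x ^ 6 := by rw [Even.pow_abs (by decide)]
      _ ≤ _ := mul_le_mul_of_nonneg_left (pow_six_le x t hx ht) (sq_nonneg C)
  refine ⟨MvPolynomial.C (C ^ 2) * (MvPolynomial.C 2 * MvPolynomial.X 1 ^ 2 + MvPolynomial.C 18),
    ?_, ?_⟩
  · refine (MvPolynomial.totalDegree_mul _ _).trans ?_
    rw [MvPolynomial.totalDegree_C, zero_add]
    refine (MvPolynomial.totalDegree_add _ _).trans (max_le ?_ (by simp))
    refine (MvPolynomial.totalDegree_mul _ _).trans ?_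
    rw [MvPolynomial.totalDegree_C, zero_add, MvPolynomial.totalDegree_X_pow]
  · intro p hp
    simp only [map_mul, map_add, map_pow, MvPolynomial.eval_C, MvPolynomial.eval_X]
    rcases hp with hp | hp
    · obtain ⟨x, t, hx, h1, h2, rfl⟩ := (mem_lowerTentacle_iff p).1 hp
      have := key (-x) (-t) (by rw [abs_neg]; exact hx.trans (le_abs_self x))
        (by rw [abs_neg, abs_of_nonneg] <;> linarith)
      rw [← hf, eval_reflectX]
      exact this
    · obtain ⟨x, t, hx, h1, h2, rfl⟩ := (mem_upperTentacle_iff p).1 hp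
      exact key x t (hx.trans (le_abs_self x)) (by rw [abs_of_nonneg] <;> linarith)

/-! ### Infinite dimension of the growth module of degree one -/

/-- The coefficient of `x ^ 2`, as a polynomial in `t`. -/
noncomputable def coeffTwo : CurveRing →ₗ[ℝ] ℝ[X] where
  toFun h := h.coeff 2
  map_add' := by simp
  map_smul' := by simp

/-- Taking the coefficient of `x ^ 2` maps the module onto `ℝ[t]`: the exponent 2 exceeds the
uncontrolled degree 1 and stays within the admissible degree 3. -/
theorem not_finite_growthModule_one :
    ¬ Module.Finite ℝ (GrowthModule (lowerTentacle ∪ upperTentacle) 1) := by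
  intro hfin
  refine Polynomial.not_finite (R := ℝ) ?_
  refine Module.Finite.of_surjective ((coeffTwo ∘ₗ toCurve.toLinearMap) ∘ₗ
    (GrowthModule (lowerTentacle ∪ upperTentacle) 1).subtype) fun g => ?_
  let h : CurveRing := AddMonoidAlgebra.single 2 g
  have hh : h ∈ totalDegreeLE (2 + g.natDegree : ℕ) := by
    refine mem_monomialSpan_of_coeff fun e l hel => ?_
    change (h.coeff e).coeff l = 0
    rw [AddMonoidAlgebra.coeff_single, Finsupp.single_apply]
    split_ifs with he
    · refine coeff_eq_zero_of_natDegree_lt ?_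
      push_cast at hel
      omega
    · simp
  obtain ⟨f, hf, hf'⟩ := exists_sub_mem_xDegreeLE _ h hh
  have hmem : toCurve f ∈ xDegreeLE 3 := by
    rw [← sub_add_cancel (toCurve f) h]
    refine add_mem (monomialSpan_mono (fun e l h => by omega) hf') ?_
    refine mem_monomialSpan_of_coeff fun e l hel => ?_
    change (h.coeff e).coeff l = 0
    rw [AddMonoidAlgebra.coeff_single, Finsupp.single_apply, if_neg (by omega)]
    simp
  refine ⟨⟨f, mem_growthModule_one hf hmem⟩, ?_⟩
  change (toCurve f).coeff 2 = g
  ext l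
  have := curveCoeff_eq_zero hf' (e := 2) (l := l) (by norm_num)
  rw [map_sub, sub_eq_zero] at this
  change ((toCurve f).coeff 2).coeff l = (h.coeff 2).coeff l at this
  rw [this, AddMonoidAlgebra.coeff_single, Finsupp.single_eq_same]

/-! ### Boundedness on a tentacle bounds the degree in `x` -/

lemma natDegree_le_of_forall_abs_eval_le {P : ℝ[X]} {ε C : ℝ} {n : ℕ} (hε : ε ≠ 0)
    (h : ∀ x : ℝ, 1 ≤ x → |P.eval (ε * x)| ≤ C * x ^ n) : P.natDegree ≤ n := by
  have hd : (P.comp (Polynomial.C ε * X)).natDegree = P.natDegree := by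
    rw [natDegree_comp, natDegree_C_mul_X ε hε, mul_one]
  rw [← hd]
  by_contra! hlt
  have hdeg : (X ^ n : ℝ[X]).degree < (P.comp (Polynomial.C ε * X)).degree := by
    rw [degree_X_pow]
    by_contra! hle
    exact absurd (natDegree_le_of_degree_le hle) (by omega)
  have ht := Polynomial.abs_div_tendsto_atTop_atTop_of_degree_gt _ _ hdeg
    (pow_ne_zero n X_ne_zero)
  obtain ⟨x, hx, hx1⟩ := ((ht.eventually_gt_atTop C).and (Filter.eventually_ge_atTop 1)).exists
  have hpos : (0 : ℝ) < x ^ n := by positivity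
  have := h x hx1
  simp only [eval_pow, eval_X, eval_comp, eval_mul, eval_C, abs_div, abs_of_pos hpos,
    lt_div_iff₀ hpos] at hx
  linarith

/-- For each fixed `t` in an interval, boundedness as `x` goes to infinity kills the coefficients of
positive powers of `x`. These are polynomials in `t` with infinitely many roots, hence zero. The
sign `ε` selects the tentacle. -/
lemma mem_xDegreeLE_zero_of_bounded {h : CurveRing} {ε C : ℝ} (hε : ε ≠ 0)
    (hb : ∀ (x : ℝˣ) (t : ℝ), 1 ≤ ε * (x : ℝ) → 1 ≤ ε * t → ε * t ≤ 2 →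
      |curveEval x t h| ≤ C) : h ∈ xDegreeLE 0 := by
  obtain ⟨n, F, hF⟩ := LaurentPolynomial.exists_T_pow h
  refine mem_monomialSpan_of_coeff fun e l he => ?_
  lift e to ℕ using by omega
  have hcoeff : h.coeff e = F.coeff (e + n) := by
    have h1 : (h * T n).coeff (e + n) = h.coeff e := by
      rw [T, AddMonoidAlgebra.coeff_mul_single_add, mul_one]
    rw [← h1, ← hF, toLaurent_apply, AddMonoidAlgebra.coeff_mapDomain]
    exact Finsupp.mapDomain_apply Nat.cast_injective _ (e + n)
  change (h.coeff e).coeff l = 0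
  suffices h.coeff e = 0 by rw [this, coeff_zero]
  rw [hcoeff]
  refine Polynomial.eq_zero_of_infinite_isRoot _ (Set.Infinite.mono (s := (ε⁻¹ * ·) '' Set.Icc 1 2)
    ?_ ((Set.Icc_infinite (by norm_num)).image (by
      intro a _ b _ hab; exact mul_left_cancel₀ (inv_ne_zero hε) hab)))
  rintro _ ⟨t, ⟨ht1, ht2⟩, rfl⟩
  -- `F = h * x ^ n` specialised at this `t` grows at most like `x ^ n`.
  have hdeg : (F.map (evalRingHom (ε⁻¹ * t))).natDegree ≤ n := by
    refine natDegree_le_of_forall_abs_eval_le (ε := ε⁻¹) (C := C * |ε⁻¹| ^ n)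
      (inv_ne_zero hε) fun x hx => ?_
    have hx0 : ε⁻¹ * x ≠ 0 := mul_ne_zero (inv_ne_zero hε) (by positivity)
    have h1 := hb (Units.mk0 _ hx0) (ε⁻¹ * t) (by simpa [hε] using hx) (by simpa [hε] using ht1)
      (by simpa [hε] using ht2)
    have h2 := congrArg (curveEval (Units.mk0 _ hx0) (ε⁻¹ * t)) hF
    rw [map_mul, curveEval, LaurentPolynomial.eval₂_toLaurent, LaurentPolynomial.eval₂_T_n,
      Units.val_mk0, ← eval_map] at h2
    rw [h2, abs_mul, mul_assoc]
    refine mul_le_mul h1 (le_of_eq ?_) (abs_nonneg _) ((abs_nonneg _).trans h1)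
    rw [abs_pow, abs_mul, mul_pow, abs_of_pos (by positivity : 0 < x)]
  have := coeff_eq_zero_of_natDegree_lt (n := e + n) (lt_of_le_of_lt hdeg (by omega))
  rwa [coeff_map] at this

/-! ### Bounded even polynomials are constant -/

/-- The polynomial `((y ^ 2 - x ^ 6) / 2) ^ c * x ^ (2 * a) * y ^ b`. -/
noncomputable def evenElement (i : ℕ × ℕ × Fin 2) : MvPolynomial (Fin 2) ℝ :=
  halfDiff ^ i.1 * (MvPolynomial.X 0 ^ 2) ^ i.2.1 * MvPolynomial.X 1 ^ (i.2.2 : ℕ)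

lemma X_one_sq : (MvPolynomial.X 1 ^ 2 : MvPolynomial (Fin 2) ℝ) =
    (2 : ℝ) • halfDiff + MvPolynomial.X 0 ^ 6 := by
  rw [halfDiff, ← MvPolynomial.smul_eq_C_mul, smul_smul]
  norm_num

/-- Since `y ^ 2 = 2 * halfDiff + x ^ 6`, exponents 0 and 1 of `y` suffice. -/
lemma X_one_mul_evenElement_mem (i : ℕ × ℕ × Fin 2) :
    MvPolynomial.X 1 * evenElement i ∈ Submodule.span ℝ (Set.range evenElement) := by
  obtain ⟨c, a, b⟩ := i
  fin_cases b
  · refine Submodule.subset_span ⟨(c, a, 1), ?_⟩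
    simp only [evenElement, Fin.val_one]
    ring
  · have : MvPolynomial.X 1 * evenElement (c, a, 1) =
        (2 : ℝ) • evenElement (c + 1, a, 0) + evenElement (c, a + 3, 0) := by
      have h : MvPolynomial.X 1 * evenElement (c, a, 1) =
          halfDiff ^ c * (MvPolynomial.X 0 ^ 2) ^ a * MvPolynomial.X 1 ^ 2 := by
        simp only [evenElement, Fin.val_one]
        ring
      rw [h, X_one_sq, mul_add, mul_smul_comm]
      simp only [evenElement, Fin.val_zero]
      congr 1
      · congr 1; ring
      · ring
    change MvPolynomial.X 1 * evenElement (c, a, 1) ∈ _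
    rw [this]
    exact add_mem (Submodule.smul_mem _ _ (Submodule.subset_span ⟨_, rfl⟩))
      (Submodule.subset_span ⟨_, rfl⟩)

lemma even_monomial_mem (a j : ℕ) :
    (MvPolynomial.X 1 ^ j * (MvPolynomial.X 0 ^ 2) ^ a : MvPolynomial (Fin 2) ℝ) ∈
      Submodule.span ℝ (Set.range evenElement) := by
  induction j with
  | zero => exact Submodule.subset_span ⟨(0, a, 0), by simp [evenElement]⟩
  | succ j ih =>
    rw [pow_succ', mul_assoc]
    generalize (MvPolynomial.X 1 ^ j * (MvPolynomial.X 0 ^ 2) ^ a : MvPolynomial (Fin 2) ℝ) = p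
      at ih ⊢
    induction ih using Submodule.span_induction with
    | mem p hp => obtain ⟨i, rfl⟩ := hp; exact X_one_mul_evenElement_mem i
    | zero => simp
    | add p q _ _ hp hq => rw [mul_add]; exact add_mem hp hq
    | smul r p _ hp => rw [mul_smul_comm]; exact Submodule.smul_mem _ _ hp

lemma add_reflectX_mem (f : MvPolynomial (Fin 2) ℝ) :
    f + reflectX f ∈ Submodule.span ℝ (Set.range evenElement) := by
  induction f using MvPolynomial.induction_on' with
  | add p q hp hq =>
    rw [map_add, add_add_add_comm]
    exact add_mem hp hq
  | monomial u r =>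
    have h : MvPolynomial.monomial u r =
        r • (MvPolynomial.X 1 ^ u 1 * MvPolynomial.X 0 ^ u 0 : MvPolynomial (Fin 2) ℝ) := by
      rw [MvPolynomial.monomial_eq, Finsupp.prod_fintype _ _ (by simp), Fin.prod_univ_two,
        MvPolynomial.smul_eq_C_mul, mul_comm (MvPolynomial.X 1 ^ u 1)]
    rw [h, map_smul, ← smul_add]
    refine Submodule.smul_mem _ _ ?_
    have h' : reflectX (MvPolynomial.X 1 ^ u 1 * MvPolynomial.X 0 ^ u 0) =
        MvPolynomial.X 1 ^ u 1 * (-MvPolynomial.X 0) ^ u 0 := by simp [reflectX]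
    rw [h']
    rcases Nat.even_or_odd (u 0) with he | ho
    · rw [he.neg_pow, ← two_smul ℝ]
      obtain ⟨a, ha⟩ := he
      rw [ha, ← two_mul, pow_mul]
      exact Submodule.smul_mem _ _ (even_monomial_mem a (u 1))
    · rw [ho.neg_pow, mul_neg, add_neg_cancel]
      exact zero_mem _

lemma mem_span_evenElement {f : MvPolynomial (Fin 2) ℝ} (hf : reflectX f = f) :
    f ∈ Submodule.span ℝ (Set.range evenElement) := by
  have h := Submodule.smul_mem _ (1 / 2 : ℝ) (add_reflectX_mem f)
  rw [hf, ← two_smul ℝ, smul_smul] at h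
  simpa using h

/-- The degree in `x` of the factor free of `t` in the leading form of `evenElement i`. -/
def xWeight (i : ℕ × ℕ × Fin 2) : ℕ := 2 * i.2.1 + 3 * i.2.2

lemma hasLeadingForm_evenElement (i : ℕ × ℕ × Fin 2) :
    HasLeadingForm (i.1 + xWeight i : ℕ) (toCurve (evenElement i))
      ((curveMonomial 1 0 + curveMonomial 0 1) ^ i.1 * curveMonomial (xWeight i) 0) := by
  rw [evenElement, map_mul, map_mul, map_pow, map_pow, map_pow toCurve (MvPolynomial.X 1)]
  convert! ((hasLeadingForm_halfDiff.pow i.1).mul (hasLeadingForm_X_sq.pow i.2.1)).mul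
    (hasLeadingForm_X_one.pow i.2.2) using 1
  · simp only [xWeight]; push_cast; ring
  · rw [curveMonomial_pow, curveMonomial_pow, mul_assoc, curveMonomial_mul]
    congr 2
    simp only [xWeight]; push_cast; ring

lemma curveCoeff_leadingForm (c k l : ℕ) (e : ℤ) (h : e + l = c + k) :
    curveCoeff e l ((curveMonomial 1 0 + curveMonomial 0 1) ^ c * curveMonomial k 0) =
      (c.choose l : ℝ) := by
  have expand : (curveMonomial 1 0 + curveMonomial 0 1) ^ c * curveMonomial k 0 =
      ∑ m ∈ Finset.range (c + 1), (c.choose m : ℝ) • curveMonomial (m + k) (c - m) := by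
    rw [add_pow, Finset.sum_mul]
    refine Finset.sum_congr rfl fun m _ => ?_
    rw [curveMonomial_pow, curveMonomial_pow, curveMonomial_mul, mul_right_comm,
      curveMonomial_mul, Nat.cast_smul_eq_nsmul, nsmul_eq_mul, mul_comm]
    simp
  rw [expand, map_sum]
  simp only [map_smul, curveCoeff_curveMonomial, smul_eq_mul]
  by_cases hl : l ≤ c
  · rw [Finset.sum_eq_single (c - l)]
    · rw [if_pos (by omega), mul_one, Nat.choose_symm hl]
    · intro m hm hne
      rw [Finset.mem_range] at hm
      rw [if_neg (by omega), mul_zero]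
    · intro hm
      rw [Finset.mem_range] at hm
      omega
  · rw [Nat.choose_eq_zero_of_lt (by omega), Nat.cast_zero]
    refine Finset.sum_eq_zero fun m hm => ?_
    rw [if_neg (by omega), mul_zero]

/-- The error term lies strictly below the leading degree, so only the leading form contributes
here. -/
lemma curveCoeff_evenElement (i : ℕ × ℕ × Fin 2) (e : ℤ) (l : ℕ) (h : i.1 + xWeight i ≤ e + l) :
    curveCoeff e l (toCurve (evenElement i)) =
      if e + l = (i.1 + xWeight i : ℕ) then ((i.1).choose l : ℝ) else 0 := by
  have hi := hasLeadingForm_evenElement i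
  have h0 : curveCoeff e l (toCurve (evenElement i) - _) = 0 :=
    curveCoeff_eq_zero hi.2 (by push_cast; omega)
  rw [map_sub, sub_eq_zero] at h0
  rw [h0]
  split_ifs with he
  · exact curveCoeff_leadingForm _ _ _ _ (by push_cast at he; exact he)
  · exact curveCoeff_eq_zero hi.1 (by push_cast at he ⊢; omega)

/-- The parity of `2 * a + 3 * b` determines `b ∈ {0, 1}`, and then `a`. -/
lemma xWeight_injective {i j : ℕ × ℕ × Fin 2} (h1 : i.1 = j.1) (h2 : xWeight i = xWeight j) :
    i = j := by
  obtain ⟨c, a, b⟩ := i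
  obtain ⟨c', a', b'⟩ := j
  simp only [xWeight] at h1 h2
  have := b.isLt
  have := b'.isLt
  simp only [Prod.mk.injEq, Fin.ext_iff]
  omega

/-- An even polynomial bounded on the curves is constant. -/
theorem exists_eq_C_of_even {f : MvPolynomial (Fin 2) ℝ} (hf : reflectX f = f)
    (h : toCurve f ∈ xDegreeLE 0) : ∃ r, f = MvPolynomial.C r := by
  obtain ⟨g, rfl⟩ := (Finsupp.mem_span_range_iff_exists_finsupp).1 (mem_span_evenElement hf)
  rcases g.support.eq_empty_or_nonempty with hg | hg
  · exact ⟨0, by simp [Finsupp.sum, hg]⟩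
  obtain ⟨j, hj, hmax⟩ := g.support.exists_max_image (fun i => i.1 + xWeight i) hg
  -- Among the terms of top total degree `N`, `i₀` has the least power of `x` as a factor of its
  -- leading form.
  obtain ⟨i₀, hi₀, hmin⟩ := (g.support.filter fun i =>
    i.1 + xWeight i = j.1 + xWeight j).exists_min_image xWeight ⟨j, by simpa using hj⟩
  rw [Finset.mem_filter] at hi₀
  set N := j.1 + xWeight j
  by_cases hN : N = 0
  · refine ⟨∑ i ∈ g.support, g i, ?_⟩
    rw [Finsupp.sum, map_sum]
    refine Finset.sum_congr rfl fun i hi => ?_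
    have h1 := hmax i hi
    have : i = (0, 0, 0) := xWeight_injective (by simp only; omega)
      (by simp only [xWeight] at h1 ⊢; simp; omega)
    rw [MvPolynomial.C_eq_smul_one, this]
    simp [evenElement]
  exfalso
  have vanish : ∀ e l : ℕ, 1 ≤ e → e + l = N → ∑ i ∈ g.support, g i *
      (if i.1 + xWeight i = N then ((i.1).choose l : ℝ) else 0) = 0 := by
    intro e l he hel
    have h0 := curveCoeff_eq_zero h (e := e) (l := l) (by omega)
    rw [Finsupp.sum, map_sum, map_sum] at h0
    refine Eq.trans (Finset.sum_congr rfl fun i hi => ?_) h0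
    have h1 := hmax i hi
    rw [map_smul, map_smul, smul_eq_mul, curveCoeff_evenElement i e l (by omega)]
    congr 1
    refine if_congr ?_ rfl rfl
    omega
  -- If `i₀` is the only top term whose binomial expansion reaches `t ^ l`, the coefficient of `x ^
  -- (N - l) * t ^ l` is a nonzero multiple of `g i₀`, yet it must vanish.
  have single : ∀ l : ℕ, l < N → (∀ i, i.1 + xWeight i = N → xWeight i₀ ≤ xWeight i → i ≠ i₀ →
      i.1 < l) → l ≤ i₀.1 → False := by
    intro l hl hlt hle
    have h0 := vanish (N - l) l (by omega) (by omega)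
    rw [Finset.sum_eq_single_of_mem i₀ hi₀.1, if_pos hi₀.2] at h0
    · rcases mul_eq_zero.1 h0 with h0 | h0
      · exact Finsupp.mem_support_iff.1 hi₀.1 h0
      · exact (Nat.choose_pos hle).ne' (by exact_mod_cast h0)
    · intro i hi hne
      split_ifs with hw
      · rw [Nat.choose_eq_zero_of_lt, Nat.cast_zero, mul_zero]
        exact hlt i hw (hmin i (Finset.mem_filter.2 ⟨hi, hw⟩)) hne
      · rw [mul_zero]
  have hne1 : ∀ i, xWeight i ≠ 1 := fun i => by simp only [xWeight]; omega
  have hlt : ∀ i, i.1 + xWeight i = N → xWeight i₀ ≤ xWeight i → i ≠ i₀ →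
      xWeight i₀ < xWeight i := by
    intro i hw hle hne
    refine lt_of_le_of_ne hle fun heq => hne (xWeight_injective ?_ heq.symm)
    omega
  by_cases hk : xWeight i₀ = 0
  -- Here `i₀` has leading form `(x + t) ^ N`. Weight 1 does not occur, so the other top terms are
  -- divisible by `x ^ 2` and leave `x * t ^ (N - 1)` alone.
  · refine single (N - 1) (by omega) (fun i hw hle hne => ?_) (by omega)
    have := hlt i hw hle hne
    have := hne1 i
    omega
  -- The lowest power of `x` in the top form is positive and comes from `i₀` only.
  · refine single i₀.1 (by omega) (fun i hw hle hne => ?_) le_rfl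
    have := hlt i hw hle hne
    omega

/-! ### From even polynomials to all polynomials -/

lemma reflectX_reflectX (f : MvPolynomial (Fin 2) ℝ) : reflectX (reflectX f) = f := by
  have h : reflectX.comp reflectX = AlgHom.id ℝ _ := by
    refine MvPolynomial.algHom_ext fun i => ?_
    fin_cases i <;> simp [reflectX]
  exact AlgHom.congr_fun h f

lemma mul_mem_xDegreeLE_zero {a b : CurveRing} (ha : a ∈ xDegreeLE 0) (hb : b ∈ xDegreeLE 0) :
    a * b ∈ xDegreeLE 0 := by
  have h := Submodule.mul_mem_mul ha hb
  refine (?_ : xDegreeLE 0 * xDegreeLE 0 ≤ _) h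
  unfold xDegreeLE monomialSpan
  rw [Submodule.span_mul_span, Submodule.span_le]
  rintro _ ⟨_, ⟨e, l, h1, rfl⟩, _, ⟨e', l', h2, rfl⟩, rfl⟩
  exact Submodule.subset_span ⟨e + e', l + l', by omega, curveMonomial_mul _ _ _ _⟩

theorem exists_eq_C_of_bounded {p : MvPolynomial (Fin 2) ℝ} {C : ℝ}
    (h : ∀ x ∈ lowerTentacle ∪ upperTentacle, |MvPolynomial.eval x p| ≤ C) :
    ∃ r, p = MvPolynomial.C r := by
  have h1 : toCurve p ∈ xDegreeLE 0 := by
    refine mem_xDegreeLE_zero_of_bounded (ε := 1) (C := C) one_ne_zero fun x t hx h1 h2 => ?_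
    rw [one_mul] at hx h1 h2
    rw [curveEval_toCurve]
    exact h _ (Or.inr ((mem_upperTentacle_iff _).2 ⟨x, t, hx, h1, h2, rfl⟩))
  have h2 : toCurve (reflectX p) ∈ xDegreeLE 0 := by
    refine mem_xDegreeLE_zero_of_bounded (ε := -1) (C := C) (by norm_num) fun x t hx h1 h2 => ?_
    rw [neg_one_mul] at hx h1 h2
    rw [curveEval_toCurve, show curvePoint x t = ![(x : ℝ), curvePoint x t 1] from rfl,
      eval_reflectX]
    refine h _ (Or.inl ((mem_lowerTentacle_iff _).2 ⟨-x, -t, hx, h1, h2, ?_⟩))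
    rw [neg_neg, neg_neg]
  obtain ⟨s, hs⟩ := exists_eq_C_of_even (f := p + reflectX p)
    (by rw [map_add, reflectX_reflectX, add_comm]) (by rw [map_add]; exact add_mem h1 h2)
  obtain ⟨m, hm⟩ := exists_eq_C_of_even (f := p * reflectX p)
    (by rw [map_mul, reflectX_reflectX, mul_comm])
    (by rw [map_mul]; exact mul_mem_xDegreeLE_zero h1 h2)
  -- Completing the square in `p ^ 2 - s * p + m = 0`; a polynomial with constant square is
  -- constant.
  have hsq : (p - MvPolynomial.C (s / 2)) ^ 2 = MvPolynomial.C (s ^ 2 / 4 - m) := by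
    have e1 : (MvPolynomial.C s : MvPolynomial (Fin 2) ℝ) = 2 * MvPolynomial.C (s / 2) := by
      rw [← map_ofNat (MvPolynomial.C : ℝ →+* MvPolynomial (Fin 2) ℝ) 2, ← map_mul]
      congr 1; ring
    have e2 : (MvPolynomial.C (s ^ 2 / 4 - m) : MvPolynomial (Fin 2) ℝ) =
        MvPolynomial.C (s / 2) ^ 2 - MvPolynomial.C m := by
      rw [← map_pow, ← map_sub]
      congr 1; ring
    rw [e2, ← hm, ← sub_eq_iff_eq_add'.2 hs.symm, e1]
    ring
  have hdeg : (p - MvPolynomial.C (s / 2)).totalDegree = 0 := by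
    have := congrArg MvPolynomial.totalDegree hsq
    rw [MvPolynomial.totalDegree_C] at this
    by_cases h0 : p - MvPolynomial.C (s / 2) = 0
    · rw [h0, MvPolynomial.totalDegree_zero]
    · rw [sq, MvPolynomial.totalDegree_mul_of_isDomain h0 h0] at this
      omega
  rw [MvPolynomial.totalDegree_eq_zero_iff_eq_C] at hdeg
  exact ⟨_ + s / 2, by rw [map_add, ← sub_eq_iff_eq_add]; exact hdeg⟩

theorem growthModule_zero :
    (GrowthModule (lowerTentacle ∪ upperTentacle) 0 : Set (MvPolynomial (Fin 2) ℝ)) =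
      Set.range (MvPolynomial.C : ℝ →+* MvPolynomial (Fin 2) ℝ) := by
  ext p
  constructor
  · rintro ⟨q, hq, h⟩
    rw [mul_zero, Nat.le_zero, MvPolynomial.totalDegree_eq_zero_iff_eq_C] at hq
    obtain ⟨r, hr⟩ := exists_eq_C_of_bounded (p := p) (C := √(q.coeff 0)) fun x hx => by
      have := h x hx
      rw [hq, MvPolynomial.eval_C] at this
      exact Real.abs_le_sqrt this
    exact ⟨r, hr.symm⟩
  · rintro ⟨r, rfl⟩
    exact ⟨MvPolynomial.C (r ^ 2), by rw [MvPolynomial.totalDegree_C], fun x _ => by simp⟩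

/-! ### Basic closedness and regularity -/

theorem isBasicClosed_tentacles : IsBasicClosed (lowerTentacle ∪ upperTentacle) := by
  classical
  let x : MvPolynomial (Fin 2) ℝ := MvPolynomial.X 0
  let u : MvPolynomial (Fin 2) ℝ := x ^ 3 * MvPolynomial.X 1 - x
  -- For fixed `x`, `u` ranges over `[1 - x ^ 6, 2 - x ^ 6] ∪ [1 + x ^ 6, 2 + x ^ 6]`. Two
  -- inequalities bound the hull, and the product removes the gap, as `2 - x ^ 6 ≤ 1 + x ^ 6` for `x
  -- ≥ 1`.
  refine ⟨{x - 1, u + x ^ 6 - 1, 2 + x ^ 6 - u, (u + x ^ 6 - 2) * (u - x ^ 6 - 1)}, ?_⟩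
  ext p
  simp only [Set.mem_union, lowerTentacle, upperTentacle, Set.mem_ofPred_eq, Finset.mem_insert,
    Finset.mem_singleton, forall_eq_or_imp, forall_eq, x, u, map_sub, map_add, map_mul, map_pow,
    MvPolynomial.eval_X, map_one, map_ofNat]
  generalize p 0 ^ 3 * p 1 = v
  constructor
  · rintro (⟨h0, h1, h2⟩ | ⟨h0, h1, h2⟩) <;>
      have h6 : 1 ≤ p 0 ^ 6 := one_le_pow₀ h0
    · exact ⟨by linarith, by linarith, by linarith,
        mul_nonneg_of_nonpos_of_nonpos (by linarith) (by linarith)⟩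
    · exact ⟨by linarith, by linarith, by linarith, mul_nonneg (by linarith) (by linarith)⟩
  · rintro ⟨h0, h1, h2, h3⟩
    have h0' : 1 ≤ p 0 := by linarith
    have h6 : 1 ≤ p 0 ^ 6 := one_le_pow₀ h0'
    rcases mul_nonneg_iff.1 h3 with ⟨ha, hb⟩ | ⟨ha, hb⟩
    · exact Or.inr ⟨h0', by linarith, by linarith⟩
    · exact Or.inl ⟨h0', by linarith, by linarith⟩

lemma mem_closure_tentacle (c : ℝ) {p : Fin 2 → ℝ}
    (h0 : 1 ≤ p 0) (h1 : 1 ≤ p 0 ^ 3 * p 1 + c * p 0 ^ 6 - p 0)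
    (h2 : p 0 ^ 3 * p 1 + c * p 0 ^ 6 - p 0 ≤ 2) :
    p ∈ closure {x : Fin 2 → ℝ | 1 < x 0 ∧ 1 < x 0 ^ 3 * x 1 + c * x 0 ^ 6 - x 0 ∧
      x 0 ^ 3 * x 1 + c * x 0 ^ 6 - x 0 < 2} := by
  set t := p 0 ^ 3 * p 1 + c * p 0 ^ 6 - p 0 with ht
  -- Moving `x` to the right and the strip parameter `t` towards the midpoint `3 / 2` of `[1, 2]`
  -- makes all inequalities strict for `0 < s < 1`.
  let γ : ℝ → Fin 2 → ℝ := fun s => ![p 0 + s,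
    ((t + s * (3 / 2 - t)) + (p 0 + s) - c * (p 0 + s) ^ 6) / (p 0 + s) ^ 3]
  have hp : p 0 ≠ 0 := by positivity
  have hγ0 : γ 0 = p := by
    ext i
    fin_cases i
    · simp [γ]
    · simp only [γ, ht, Fin.mk_one, Matrix.cons_val_one, Matrix.cons_val_fin_one, add_zero,
        zero_mul]
      field_simp
      ring
  have hcont : ContinuousAt γ 0 := by
    refine continuousAt_pi.2 fun i => ?_
    fin_cases i
    · simp only [γ, Fin.zero_eta, Matrix.cons_val_zero]
      fun_prop
    · simp only [γ, Fin.mk_one, Matrix.cons_val_one, Matrix.cons_val_fin_one]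
      refine ContinuousAt.div (by fun_prop) (by fun_prop) (by simpa using hp)
  have htend : Filter.Tendsto γ (nhdsWithin 0 (Set.Ioi 0)) (nhds p) := by
    have := hcont.tendsto
    rw [hγ0] at this
    exact this.mono_left nhdsWithin_le_nhds
  refine mem_closure_of_tendsto htend ?_
  filter_upwards [Ioo_mem_nhdsGT (show (0 : ℝ) < 1 by norm_num)] with s hs
  have hs0 : p 0 + s ≠ 0 := by have := hs.1; positivity
  have key : (p 0 + s) ^ 3 * (((t + s * (3 / 2 - t)) + (p 0 + s) - c * (p 0 + s) ^ 6) /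
      (p 0 + s) ^ 3) + c * (p 0 + s) ^ 6 - (p 0 + s) = t + s * (3 / 2 - t) := by
    field_simp
    ring
  simp only [γ, Matrix.cons_val_zero, Matrix.cons_val_one,
    Matrix.cons_val_fin_one, key]
  obtain ⟨hs1, hs2⟩ := hs
  exact ⟨by linarith, by nlinarith, by nlinarith⟩

theorem isRegularSet_tentacles : IsRegularSet (lowerTentacle ∪ upperTentacle) := by
  let U : ℝ → Set (Fin 2 → ℝ) := fun c => {x | 1 < x 0 ∧
    1 < x 0 ^ 3 * x 1 + c * x 0 ^ 6 - x 0 ∧ x 0 ^ 3 * x 1 + c * x 0 ^ 6 - x 0 < 2}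
  have hU : ∀ c, IsOpen (U c) := fun c => by
    have hf : Continuous fun x : Fin 2 → ℝ => x 0 ^ 3 * x 1 + c * x 0 ^ 6 - x 0 := by fun_prop
    exact (isOpen_lt continuous_const (continuous_apply 0)).inter
      ((isOpen_lt continuous_const hf).inter (isOpen_lt hf continuous_const))
  refine ⟨U 1 ∪ U (-1), (hU 1).union (hU (-1)), ?_, ?_⟩
  · rintro x (⟨h0, h1, h2⟩ | ⟨h0, h1, h2⟩)
    · exact Or.inl ⟨h0.le, by linarith, by linarith⟩
    · exact Or.inr ⟨h0.le, by linarith, by linarith⟩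
  · rintro x (⟨h0, h1, h2⟩ | ⟨h0, h1, h2⟩)
    · exact closure_mono Set.subset_union_left
        (mem_closure_tentacle 1 h0 (by linarith) (by linarith))
    · exact closure_mono Set.subset_union_right
        (mem_closure_tentacle (-1) h0 (by linarith) (by linarith))

theorem mainTheorem3 :
    IsBasicClosed (lowerTentacle ∪ upperTentacle) ∧
    IsRegularSet (lowerTentacle ∪ upperTentacle) ∧
    (GrowthModule (lowerTentacle ∪ upperTentacle) 0 : Set (MvPolynomial (Fin 2) ℝ)) =
      Set.range (MvPolynomial.C : ℝ →+* MvPolynomial (Fin 2) ℝ) ∧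
    ¬ Module.Finite ℝ (GrowthModule (lowerTentacle ∪ upperTentacle) 1) :=
  ⟨isBasicClosed_tentacles, isRegularSet_tentacles, growthModule_zero,
    not_finite_growthModule_one⟩
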